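/- **Theorem (implicit bias in function space).** Let $\mathcal W,\mathcal B$ be real random variables with finite second moments and $\mathbb P(\mathcal W=0)=0$, let $\mathcal C=-\mathcal B/\mathcal W$, and let $\nu$ be the law of $(\mathcal W,\mathcal C)$. Assume that $\mathcal C$ has a density $p_{\mathcal C}$, and let $\zeta(x)=p_{\mathcal C}(x)\,\mathbb E(\mathcal W^2\mid\mathcal C=x)$ (for any fixed versions of the density and of the conditional expectation). Let $(x_j,y_j)_{j=1}^m$, $m\ge 1$, be real data with $x_j\in\operatorname{supp}\zeta$ (closed support), and put $I=[\min_j x_j,\max_j x_j]$ and $S=\operatorname{supp}(\zeta)\cap I$. Integrals $\int_S k^2/\zeta$ take values in $[0,\infty]$ with $0/0=0$ and $a/0=\infty$ for $a>0$. "The solution" of a minimization problem over functions on a set $D$ means: an admissible function of finite cost that minimizes the cost and agrees on $D$ with every other minimizer. For $z=(z_j)_{j=1}^m\in\mathbb R^m$ consider the problem $$(\ast)_z\quad \min_{\gamma\in C(\mathbb R^2)\cap L^2(\nu),\;u,v\in\mathbb R}\ \int\gamma^2\,d\nu\quad\text{s.t.}\quad ux_j+v+\int\gamma(w,c)[w(x_j-c)]_+\,d\nu(w,c)=z_j,\quad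 j=1,\dots,m.$$ **(A) Zero initial function.** Let $(\bar\gamma,\bar u,\bar v)$ be a solution of $(\ast)_y$ and $g(x)=\bar ux+\bar v+\int\bar\gamma(w,c)[w(x-c)]_+\,d\nu(w,c)$. Then: 1. $g$ is $C^2$ near every $x\notin S$ and $g''(x)=0$ there. 2. If $S$ is an interval and $\zeta$ is continuous on $S$, then on $S$ the function $g$ is the solution of $$\min_{h\in C^2(S)}\int_S\frac{h''(x)^2}{\zeta(x)}\,dx\quad\text{s.t.}\quad h(x_j)=y_j,\ j=1,\dots,m.$$ 3. If $\zeta$ is continuous on $I$ ($S$ need not be an interval), then on $I$ the function $g$ is the solution of the problem of minimizing $\int_S (h'')^2/\zeta$ over all $h\in C^2(I)$ with $h''=0$ on $I\setminus S$ and $h(x_j)=y_j$ for all $j$. **(B) General initial function.** Let $f_0=f(\cdot,\theta_0)$ be the function $f(x,\theta_0)=\sum_{i=1}^n W^{(2)}_i[W^{(1)}_ix+b^{(1)}_i]_++b^{(2)}$ of a ReLU network with arbitrary width $n$ and parameters $\theta_0$. Let $(\bar\gamma,\bar u,\bar v)$ be a solution of $(\ast)_z$ with $z_j=y_j-f_0(x_j)$,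 and $g(x)=\bar ux+\bar v+\int\bar\gamma(w,c)[w(x-c)]_+\,d\nu(w,c)+f_0(x)$. Then: 1. For $x\notin S$, $g-f_0$ is $C^2$ near $x$ and $(g-f_0)''(x)=0$; if moreover $f_0$ is $C^2$ near $x$, then so is $g$, and $g''(x)=f_0''(x)$. 2. If $S$ is an interval and $\zeta$ is continuous on $S$, then on $S$ the function $g$ is the solution of the problem of minimizing $\int_S \big((h-f_0)''\big)^2/\zeta$ over all $h$ with $h-f_0\in C^2(S)$ and $h(x_j)=y_j$ for all $j$. If moreover $f_0\in C^2(S)$, then on $S$ the function $g$ is the solution of $$\min_{h\in C^2(S)}\int_S\frac{(h''(x)-f_0''(x))^2}{\zeta(x)}\,dx\quad\text{s.t.}\quad h(x_j)=y_j,\ j=1,\dots,m.$$ 3. If $\zeta$ is continuous on $I$, then on $I$ the function $g$ is the solution of the problem of minimizing $\int_S \big((h-f_0)''\big)^2/\zeta$ over all $h$ with $h-f_0\in C^2(I)$, $(h-f_0)''=0$ on $I\setminus S$ and $h(x_j)=y_j$ for all $j$. -/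

import Mathlib

open MeasureTheory ProbabilityTheory Set
open scoped ENNReal

namespace ReLUBias

/-- `p` is a (nonnegative, measurable) density function of the real random variable `X`. -/
structure IsDensityOf {Ω : Type*} [MeasurableSpace Ω] (P : Measure Ω) (X : Ω → ℝ)
    (p : ℝ → ℝ) : Prop where
  measurable : Measurable p
  nonneg : ∀ t, 0 ≤ p t
  map_eq : P.map X = volume.withDensity (fun t => ENNReal.ofReal (p t))

/-- `e` is a version of the regression function `t ↦ E(Y | X = t)`, that is, `e ∘ X` is
the conditional expectation of `Y` given (the σ-algebra generated by) `X`. -/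
structure IsCondExpFunction {Ω : Type*} [MeasurableSpace Ω] (P : Measure Ω) (Y X : Ω → ℝ)
    (e : ℝ → ℝ) : Prop where
  measurable : Measurable e
  ae_eq : (fun ω => e (X ω)) =ᵐ[P] P[Y | MeasurableSpace.comap X inferInstance]

/-- The breakpoint `C = -B / W` of a rectified linear unit with weight `W` and bias `B`. -/
noncomputable def breakpoint {Ω : Type*} (W B : Ω → ℝ) (ω : Ω) : ℝ := -B ω / W ω

/-- The law `ν` of the pair `(W, C)`. -/
noncomputable def breakpointLaw {Ω : Type*} [MeasurableSpace Ω] (P : Measure Ω)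
    (W B : Ω → ℝ) : Measure (ℝ × ℝ) :=
  P.map (fun ω => (W ω, breakpoint W B ω))

/-- The function `x ↦ u x + v + ∫ γ(w, c) [w (x - c)]₊ dν(w, c)`. -/
noncomputable def output (ν : Measure (ℝ × ℝ)) (γ : ℝ × ℝ → ℝ) (u v : ℝ) (x : ℝ) : ℝ :=
  u * x + v + ∫ z, γ z * max (z.1 * (x - z.2)) 0 ∂ν

/-- Feasibility for the infinite-width problem: `γ` is a continuous function on the plane with
finite cost `∫ γ² dν`, and the output function interpolates the data. -/
structure IsFeasible (ν : Measure (ℝ × ℝ)) {m : ℕ} (x y : Fin m → ℝ)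
    (γ : ℝ × ℝ → ℝ) (u v : ℝ) : Prop where
  continuous : Continuous γ
  memLp : MemLp γ 2 ν
  interp : ∀ j, output ν γ u v (x j) = y j

/-- `(γ, u, v)` solves the infinite-width problem: it minimizes `∫ γ² dν` among all feasible
triples. -/
structure IsParamSolution (ν : Measure (ℝ × ℝ)) {m : ℕ} (x y : Fin m → ℝ)
    (γ : ℝ × ℝ → ℝ) (u v : ℝ) : Prop where
  feasible : IsFeasible ν x y γ u v
  minimal : ∀ (γ' : ℝ × ℝ → ℝ) (u' v' : ℝ), IsFeasible ν x y γ' u' v' →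
    ∫ z, γ z ^ 2 ∂ν ≤ ∫ z, γ' z ^ 2 ∂ν

/-- The interval `[min_j x_j, max_j x_j]` (used only for a nonempty family). -/
noncomputable def dataInterval {m : ℕ} (x : Fin m → ℝ) : Set ℝ :=
  Icc (⨅ j, x j) (⨆ j, x j)

/-- `S = supp ζ ∩ [min_j x_j, max_j x_j]`, with `supp` the closed support. -/
noncomputable def dataRegion (ζ : ℝ → ℝ) {m : ℕ} (x : Fin m → ℝ) : Set ℝ :=
  tsupport ζ ∩ dataInterval x

/-- The weighted curvature cost `∫_S k(t)² / ζ(t) dt` of a curvature function `k`, with values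
in `[0, ∞]` and the conventions `0 / 0 = 0` and `a / 0 = ∞` for `a > 0`. -/
noncomputable def cost (S : Set ℝ) (ζ k : ℝ → ℝ) : ℝ≥0∞ :=
  ∫⁻ t in S, ENNReal.ofReal (k t ^ 2) / ENNReal.ofReal (ζ t)

/-- The second derivative of a function on the set `D` (one-sided at end points). -/
noncomputable def curv (D : Set ℝ) (h : ℝ → ℝ) : ℝ → ℝ := iteratedDerivWithin 2 h D

/-- `g`, as a function on `D`, is the solution of `min J(h)` over the class `A`: it belongs to
`A`, has finite cost, minimizes `J` over `A`, and every other minimizer agrees with it on `D`. -/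
structure IsTheMinimizer (D : Set ℝ) (A : Set (ℝ → ℝ)) (J : (ℝ → ℝ) → ℝ≥0∞)
    (g : ℝ → ℝ) : Prop where
  mem : g ∈ A
  finite : J g < ∞
  minimal : ∀ h ∈ A, J g ≤ J h
  unique : ∀ h ∈ A, J h ≤ J g → EqOn h g D

/-- The functions `h ∈ C²(S)` with `h(x_j) = y_j`. -/
def interpolants (S : Set ℝ) {m : ℕ} (x y : Fin m → ℝ) : Set (ℝ → ℝ) :=
  {h | ContDiffOn ℝ 2 h S ∧ ∀ j, h (x j) = y j}

/-- The functions `h` with `h(x_j) = y_j` that differ from `f₀` by an element of `C²(S)`. -/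
def shiftedInterpolants (S : Set ℝ) (f₀ : ℝ → ℝ) {m : ℕ} (x y : Fin m → ℝ) : Set (ℝ → ℝ) :=
  {h | ContDiffOn ℝ 2 (h - f₀) S ∧ ∀ j, h (x j) = y j}

/-- The functions `h` with `h(x_j) = y_j` such that `h - f₀` is `C²` on the interval `D` and
has no curvature on `D` outside `S`. -/
def gapInterpolants (D S : Set ℝ) (f₀ : ℝ → ℝ) {m : ℕ} (x y : Fin m → ℝ) : Set (ℝ → ℝ) :=
  {h | ContDiffOn ℝ 2 (h - f₀) D ∧ (∀ t ∈ D \ S, curv D (h - f₀) t = 0) ∧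
    ∀ j, h (x j) = y j}

/-- The parameters of a network with one input, `n` hidden rectified linear units and one
linear output. -/
structure NetParams (n : ℕ) where
  (w₁ b₁ w₂ : Fin n → ℝ)
  b₂ : ℝ

/-- The network function `x ↦ ∑ᵢ w₂ᵢ [w₁ᵢ x + b₁ᵢ]₊ + b₂`. -/
noncomputable def network {n : ℕ} (θ : NetParams n) (x : ℝ) : ℝ :=
  ∑ i, θ.w₂ i * max (θ.w₁ i * x + θ.b₁ i) 0 + θ.b₂

end ReLUBias

/-!
A solution of the infinite-width problem is determined by its stationarity conditions. Variations
in the directions of the admissible functions give Lagrange multipliers `μ_j`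
(`IsParamSolution.exists_multipliers`) with `γ(w, c) = ∑ μ_j [w (x_j - c)]₊` almost everywhere.
Since `u` and `v` are not penalized, `∑ μ_j = 0` and `∑ μ_j x_j = 0`. These two relations make the
dependence on the sign of `w` drop out, up to an affine function of the input, so that after
conditioning on the breakpoint the output is affine plus `∫ ζ(c) q(c) (x - c)₊ dc`, where
`q(c) = ∑ μ_j (x_j - c)₊` (`output_eq`). Hence its second derivative is `ζ q` wherever
this product is continuous in a neighborhood. The spline `q` vanishes outside the data interval
and at its end points. So `ζ q` vanishes off `S`, and it is continuous on the whole line as soon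
as `ζ` is continuous on the data interval, in which case the output is globally `C²`.

The relation `g'' / ζ = q` is the Euler-Lagrange equation of the variational problem in function
space: by Taylor's formula `∫ φ'' q = 0` for every `φ` vanishing at the data points
(`integral_curv_mul_spline`), so by Pythagoras in the space weighted by `1 / ζ` (`cost_eq_add`)
an interpolant `h` costs as much as `g` plus the cost of `h'' - g''`. This yields minimality; in
the case of equality `h - g` is affine with zeros at both ends of the data interval.

If `S` is an interval it contains the extreme data points and therefore equals the whole data
interval, so that the problem on `S` is an instance of the problem with gaps. If all data points
coincide, the costs are integrals over a null set and interpolation alone gives the claim. A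
general initial function `f₀` amounts to the translation `h ↦ h - f₀`.
-/

namespace ReLUBias

/-! ### Optimality conditions for the infinite-width problem -/

/-- The continuous functions on the plane of finite cost. -/
def admissible (ν : Measure (ℝ × ℝ)) : Submodule ℝ (ℝ × ℝ → ℝ) where
  carrier := {η | Continuous η ∧ MemLp η 2 ν}
  add_mem' := fun ha hb => ⟨ha.1.add hb.1, ha.2.add hb.2⟩
  zero_mem' := ⟨continuous_const, MemLp.zero⟩
  smul_mem' := fun c _ ha => ⟨ha.1.const_smul c, ha.2.const_smul c⟩

/-- The pairing `η ↦ ∫ η ψ dν` with a square integrable function `ψ`. -/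
noncomputable def pairing (ν : Measure (ℝ × ℝ)) (ψ : ℝ × ℝ → ℝ) (hψ : MemLp ψ 2 ν) :
    admissible ν →ₗ[ℝ] ℝ where
  toFun η := ∫ z, (η : ℝ × ℝ → ℝ) z * ψ z ∂ν
  map_add' := fun a b => by
    simp only [Submodule.coe_add, Pi.add_apply, add_mul]
    exact integral_add (a.2.2.integrable_mul hψ) (b.2.2.integrable_mul hψ)
  map_smul' := fun c a => by
    simp only [Submodule.coe_smul, Pi.smul_apply, smul_eq_mul, RingHom.id_apply, mul_assoc]
    exact integral_const_mul _ _

lemma integrable_mul_of_memLp_two {ν : Measure (ℝ × ℝ)} {f g : ℝ × ℝ → ℝ} (hf : MemLp f 2 ν)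
    (hg : MemLp g 2 ν) : Integrable (fun z => f z * g z) ν := hf.integrable_mul hg

/-- The first variation of the cost at a solution vanishes in every direction that changes none
of the data values. -/
lemma IsParamSolution.integral_mul_eq_zero {ν : Measure (ℝ × ℝ)} {m : ℕ} {x y : Fin m → ℝ}
    {γ : ℝ × ℝ → ℝ} {u v : ℝ} (h : IsParamSolution ν x y γ u v)
    (hφ : ∀ t, MemLp (fun z : ℝ × ℝ => max (z.1 * (t - z.2)) 0) 2 ν)
    {η : ℝ × ℝ → ℝ} (hη : Continuous η) (hη2 : MemLp η 2 ν) (a b : ℝ)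
    (h0 : ∀ j, ∫ z, η z * max (z.1 * (x j - z.2)) 0 ∂ν + (a * x j + b) = 0) :
    ∫ z, γ z * η z ∂ν = 0 := by
  have hγ2 := h.feasible.memLp
  have key : ∀ s : ℝ, 0 ≤ s * (2 * ∫ z, γ z * η z ∂ν) + s ^ 2 * ∫ z, η z ^ 2 ∂ν := by
    intro s
    have hf : IsFeasible ν x y (fun z => γ z + s * η z) (u + s * a) (v + s * b) := by
      refine ⟨h.feasible.continuous.add (hη.const_smul s), hγ2.add (hη2.const_mul s), fun j => ?_⟩
      have h1 := h.feasible.interp j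
      have h2 := h0 j
      unfold output at h1 ⊢
      have : ∫ z, (γ z + s * η z) * max (z.1 * (x j - z.2)) 0 ∂ν
          = ∫ z, γ z * max (z.1 * (x j - z.2)) 0 ∂ν
            + s * ∫ z, η z * max (z.1 * (x j - z.2)) 0 ∂ν := by
        rw [← integral_const_mul, ← integral_add (integrable_mul_of_memLp_two hγ2 (hφ _))
          ((integrable_mul_of_memLp_two hη2 (hφ _)).const_mul s)]
        congr 1 with z
        ring
      rw [this]
      linear_combination h1 + s * h2
    have hm := h.minimal _ _ _ hf
    have : ∫ z, (γ z + s * η z) ^ 2 ∂ν = ∫ z, γ z ^ 2 ∂ν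
        + (s * (2 * ∫ z, γ z * η z ∂ν) + s ^ 2 * ∫ z, η z ^ 2 ∂ν) := by
      have i1 := ((integrable_mul_of_memLp_two hγ2 hη2).const_mul 2).const_mul s
      have i2 := hη2.integrable_sq.const_mul (s ^ 2)
      have i3 : Integrable (fun z => s * (2 * (γ z * η z)) + s ^ 2 * η z ^ 2) ν := i1.add i2
      rw [← integral_const_mul, ← integral_const_mul, ← integral_const_mul,
        ← integral_add i1 i2, ← integral_add hγ2.integrable_sq i3]
      congr 1 with z
      ring
    linarith
  set A := ∫ z, γ z * η z ∂ν
  set Q := ∫ z, η z ^ 2 ∂ν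
  have hQ : 0 ≤ Q := integral_nonneg fun z => sq_nonneg _
  -- the step `-A / (Q + 1)` makes the linear term win over the quadratic one
  have h1 := key (-A / (Q + 1))
  have h2 : -A / (Q + 1) * (2 * A) + (-A / (Q + 1)) ^ 2 * Q
      = -(A ^ 2 * (Q + 2)) / (Q + 1) ^ 2 := by
    field_simp
    ring
  rw [h2, div_nonneg_iff] at h1
  have h3 : A ^ 2 = 0 := by
    rcases h1 with h1 | h1
    · nlinarith [sq_nonneg A]
    · nlinarith [sq_nonneg (Q + 1)]
  simpa using h3

/-- Lagrange multipliers: a solution is a combination of the rectified linear units at the data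
points, with multipliers that annihilate the affine functions (the unpenalized part). -/
lemma IsParamSolution.exists_multipliers {ν : Measure (ℝ × ℝ)} {m : ℕ} {x y : Fin m → ℝ}
    {γ : ℝ × ℝ → ℝ} {u v : ℝ} (h : IsParamSolution ν x y γ u v)
    (hφ : ∀ t, MemLp (fun z : ℝ × ℝ => max (z.1 * (t - z.2)) 0) 2 ν) :
    ∃ μ : Fin m → ℝ, ∑ j, μ j = 0 ∧ ∑ j, μ j * x j = 0 ∧
      γ =ᵐ[ν] fun z => ∑ j, μ j * max (z.1 * (x j - z.2)) 0 := by
  have hγ2 := h.feasible.memLp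
  let T : Fin m → (admissible ν × ℝ × ℝ) →ₗ[ℝ] ℝ := fun j =>
    (pairing ν _ (hφ (x j))).coprod ((LinearMap.lsmul ℝ ℝ (x j)).coprod LinearMap.id)
  let K : (admissible ν × ℝ × ℝ) →ₗ[ℝ] ℝ := (pairing ν γ hγ2).coprod 0
  have hT : ∀ j (η : admissible ν) (a b : ℝ), T j (η, a, b)
      = ∫ z, (η : ℝ × ℝ → ℝ) z * max (z.1 * (x j - z.2)) 0 ∂ν + (x j * a + b) :=
    fun j η a b => rfl
  have hK : ∀ (η : admissible ν) (a b : ℝ), K (η, a, b)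
      = ∫ z, (η : ℝ × ℝ → ℝ) z * γ z ∂ν := fun η a b => add_zero _
  have hle : ⨅ j, LinearMap.ker (T j) ≤ LinearMap.ker K := by
    rintro ⟨η, a, b⟩ hη
    simp only [Submodule.mem_iInf, LinearMap.mem_ker] at hη
    rw [LinearMap.mem_ker, hK]
    simp_rw [mul_comm _ (γ _)]
    refine h.integral_mul_eq_zero hφ η.2.1 η.2.2 a b fun j => ?_
    rw [mul_comm a]
    exact hη j
  obtain ⟨μ, hμ⟩ := (Submodule.mem_span_range_iff_exists_fun ℝ).1
    (mem_span_of_iInf_ker_le_ker hle)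
  have hμ' : ∀ (η : admissible ν) (a b : ℝ),
      ∑ j, μ j * (∫ z, (η : ℝ × ℝ → ℝ) z * max (z.1 * (x j - z.2)) 0 ∂ν + (x j * a + b))
        = ∫ z, (η : ℝ × ℝ → ℝ) z * γ z ∂ν := by
    intro η a b
    rw [← hK η a b, ← hμ]
    simp only [LinearMap.sum_apply, LinearMap.smul_apply, hT, smul_eq_mul]
  refine ⟨μ, by simpa using hμ' 0 0 1, by simpa using hμ' 0 1 0, ?_⟩
  set ψ : ℝ × ℝ → ℝ := fun z => ∑ j, μ j * max (z.1 * (x j - z.2)) 0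
  have hψc : Continuous ψ := by fun_prop
  have hψ2 : MemLp ψ 2 ν := memLp_finsetSum _ fun j _ => (hφ (x j)).const_mul (μ j)
  -- test the multiplier identity with the difference of the two sides of the claim
  let η : admissible ν := ⟨γ - ψ, h.feasible.continuous.sub hψc, hγ2.sub hψ2⟩
  have h1 := hμ' η 0 0
  have hη2 : MemLp (γ - ψ) 2 ν := hγ2.sub hψ2
  have h2 : ∑ j, μ j * (∫ z, (γ - ψ) z * max (z.1 * (x j - z.2)) 0 ∂ν + (x j * 0 + 0))
      = ∫ z, (γ - ψ) z * ψ z ∂ν := by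
    have : ∀ z, (γ - ψ) z * ψ z = ∑ j, μ j * ((γ - ψ) z * max (z.1 * (x j - z.2)) 0) := by
      intro z
      rw [Finset.mul_sum]
      exact Finset.sum_congr rfl fun j _ => by ring
    simp_rw [this]
    rw [integral_finsetSum _ fun j _ =>
      (integrable_mul_of_memLp_two hη2 (hφ (x j))).const_mul (μ j)]
    simp [integral_const_mul]
  have h3 : ∫ z, (γ - ψ) z ^ 2 ∂ν = 0 := by
    have : ∀ z, (γ - ψ) z ^ 2 = (γ - ψ) z * γ z - (γ - ψ) z * ψ z := fun z => by
      simp only [Pi.sub_apply]; ring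
    simp_rw [this]
    rw [integral_sub (integrable_mul_of_memLp_two hη2 hγ2)
      (integrable_mul_of_memLp_two hη2 hψ2), ← h2]
    exact sub_eq_zero.2 h1.symm
  rw [integral_eq_zero_iff_of_nonneg (fun z => sq_nonneg _) hη2.integrable_sq] at h3
  filter_upwards [h3] with z hz
  have : (γ - ψ) z = 0 := by simpa using hz
  simpa [sub_eq_zero] using this

/-! ### The spline of the multipliers -/

/-- The piecewise linear function `c ↦ ∑ μ_j (x_j - c)₊`. When the multipliers annihilate the
affine functions it vanishes outside the data interval and at its end points. -/
noncomputable def spline {m : ℕ} (μ x : Fin m → ℝ) (c : ℝ) : ℝ := ∑ j, μ j * max (x j - c) 0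

lemma continuous_spline {m : ℕ} (μ x : Fin m → ℝ) : Continuous (spline μ x) := by
  unfold spline; fun_prop

lemma ciInf_le_data {m : ℕ} (x : Fin m → ℝ) (j : Fin m) : ⨅ j, x j ≤ x j :=
  ciInf_le (finite_range x).bddBelow j

lemma le_ciSup_data {m : ℕ} (x : Fin m → ℝ) (j : Fin m) : x j ≤ ⨆ j, x j :=
  le_ciSup (finite_range x).bddAbove j

lemma mem_dataInterval {m : ℕ} (x : Fin m → ℝ) (j : Fin m) : x j ∈ dataInterval x :=
  ⟨ciInf_le_data x j, le_ciSup_data x j⟩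

lemma spline_eq_zero_of_le {m : ℕ} {μ x : Fin m → ℝ} (h0 : ∑ j, μ j = 0)
    (h1 : ∑ j, μ j * x j = 0) {c : ℝ} (hc : c ≤ ⨅ j, x j) : spline μ x c = 0 := by
  have : ∀ j, μ j * max (x j - c) 0 = μ j * x j - μ j * c := fun j => by
    rw [max_eq_left (sub_nonneg.2 (hc.trans (ciInf_le_data x j))), mul_sub]
  simp [spline, this, Finset.sum_sub_distrib, ← Finset.sum_mul, h0, h1]

lemma spline_eq_zero_of_ge {m : ℕ} {μ x : Fin m → ℝ} {c : ℝ} (hc : ⨆ j, x j ≤ c) :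
    spline μ x c = 0 :=
  Finset.sum_eq_zero fun j _ => by
    rw [max_eq_right (sub_nonpos.2 ((le_ciSup_data x j).trans hc)), mul_zero]

lemma spline_eq_zero_of_notMem {m : ℕ} {μ x : Fin m → ℝ} (h0 : ∑ j, μ j = 0)
    (h1 : ∑ j, μ j * x j = 0) {c : ℝ} (hc : c ∉ dataInterval x) : spline μ x c = 0 := by
  rcases lt_or_ge c (⨅ j, x j) with h | h
  · exact spline_eq_zero_of_le h0 h1 h.le
  · exact spline_eq_zero_of_ge (not_le.1 fun h' => hc ⟨h, h'⟩).le

lemma hasCompactSupport_spline {m : ℕ} {μ x : Fin m → ℝ} (h0 : ∑ j, μ j = 0)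
    (h1 : ∑ j, μ j * x j = 0) : HasCompactSupport (spline μ x) :=
  HasCompactSupport.intro isCompact_Icc fun _ hc => spline_eq_zero_of_notMem h0 h1 hc

/-- Multiplying the optimal combination of rectified linear units by a further unit gives
`w² q(c) (t - c)₊` up to a term that is affine in `t`; the sign of `w` matters only there. -/
lemma sum_relu_mul_relu {m : ℕ} {μ x : Fin m → ℝ} (h0 : ∑ j, μ j = 0)
    (h1 : ∑ j, μ j * x j = 0) (w c t : ℝ) :
    (∑ j, μ j * max (w * (x j - c)) 0) * max (w * (t - c)) 0
      = w ^ 2 * (spline μ x c * max (t - c) 0)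
        - (Iio (0 : ℝ)).indicator (fun w => w ^ 2) w * spline μ x c * (t - c) := by
  rcases le_or_gt 0 w with hw | hw
  · have e : ∀ s : ℝ, max (w * s) 0 = w * max s 0 := fun s => by
      rw [mul_max_of_nonneg _ _ hw, mul_zero]
    have e2 : ∑ j, μ j * max (w * (x j - c)) 0 = w * spline μ x c := by
      rw [spline, Finset.mul_sum]
      exact Finset.sum_congr rfl fun j _ => by rw [e]; ring
    rw [e2, e, indicator_of_notMem (by simpa using hw)]
    ring
  · have e : ∀ s : ℝ, max (w * s) 0 = w * (s - max s 0) := fun s => by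
      rcases le_total 0 s with hs | hs
      · rw [max_eq_left hs, max_eq_right (mul_nonpos_of_nonpos_of_nonneg hw.le hs)]; ring
      · rw [max_eq_right hs, max_eq_left (mul_nonneg_of_nonpos_of_nonpos hw.le hs)]; ring
    have e2 : ∑ j, μ j * max (w * (x j - c)) 0 = - (w * spline μ x c) := by
      have : ∀ j, μ j * max (w * (x j - c)) 0
          = w * (μ j * x j) - w * c * μ j - w * (μ j * max (x j - c) 0) := fun j => by
        rw [e]; ring
      simp [spline, this, Finset.sum_sub_distrib, ← Finset.mul_sum, h0, h1]
    rw [e2, e, indicator_of_mem (show w ∈ Iio (0 : ℝ) from hw)]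
    ring

/-! ### The weight `ζ` -/

section Weight

variable {Ω : Type*} [MeasurableSpace Ω] {P : Measure Ω}
  {W C : Ω → ℝ} {p e ζ : ℝ → ℝ}

lemma ae_zeta_nonneg (hC : Measurable C) (hp : IsDensityOf P C p)
    (he : IsCondExpFunction P (fun ω => W ω ^ 2) C e) (hζ : ∀ t, ζ t = p t * e t) :
    ∀ᵐ t : ℝ, 0 ≤ ζ t := by
  have h1 : ∀ᵐ ω ∂P, 0 ≤ e (C ω) := by
    have h2 : 0 ≤ᵐ[P] P[(fun ω => W ω ^ 2) | MeasurableSpace.comap C inferInstance] :=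
      condExp_nonneg (Filter.Eventually.of_forall fun ω => sq_nonneg _)
    filter_upwards [h2, he.ae_eq] with ω h h'
    rw [h']; exact h
  have h3 : ∀ᵐ t ∂(P.map C), 0 ≤ e t :=
    (ae_map_iff hC.aemeasurable (measurableSet_le measurable_const he.measurable)).2 h1
  rw [hp.map_eq, ae_withDensity_iff hp.measurable.ennreal_ofReal] at h3
  filter_upwards [h3] with t ht
  rw [hζ]
  rcases (hp.nonneg t).eq_or_lt with h | h
  · simp [← h]
  · exact mul_nonneg h.le (ht (by simpa using h))

lemma integrable_zeta (hC : Measurable C) (hp : IsDensityOf P C p)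
    (he : IsCondExpFunction P (fun ω => W ω ^ 2) C e) (hζ : ∀ t, ζ t = p t * e t) :
    Integrable ζ := by
  have h1 : Integrable (e ∘ C) P := (integrable_congr he.ae_eq).2 integrable_condExp
  rw [← integrable_map_measure he.measurable.aestronglyMeasurable hC.aemeasurable, hp.map_eq,
    integrable_withDensity_iff_integrable_smul' hp.measurable.ennreal_ofReal (by simp)] at h1
  refine h1.congr (Filter.Eventually.of_forall fun t => ?_)
  simp [hζ, ENNReal.toReal_ofReal (hp.nonneg t)]

/-- Conditioning on the breakpoint turns the factor `W²` into the weight `ζ`. -/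
lemma integral_sq_mul_comp [IsProbabilityMeasure P] (hC : Measurable C)
    (hW2 : MemLp W 2 P) (hp : IsDensityOf P C p)
    (he : IsCondExpFunction P (fun ω => W ω ^ 2) C e) (hζ : ∀ t, ζ t = p t * e t)
    {ψ : ℝ → ℝ} (hψ : Continuous ψ) (hψc : HasCompactSupport ψ) :
    ∫ ω, W ω ^ 2 * ψ (C ω) ∂P = ∫ t, ζ t * ψ t := by
  obtain ⟨M, hM⟩ := hψ.bounded_above_of_compact_support hψc
  have hint : Integrable ((fun ω => W ω ^ 2) * (ψ ∘ C)) P :=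
    hW2.integrable_sq.mul_bdd (hψ.measurable.comp hC).aestronglyMeasurable
      (Filter.Eventually.of_forall fun ω => hM _)
  have hsm : StronglyMeasurable[MeasurableSpace.comap C inferInstance] (ψ ∘ C) :=
    (hψ.measurable.comp (comap_measurable C)).stronglyMeasurable
  have h1 := condExp_mul_of_stronglyMeasurable_right hsm hint hW2.integrable_sq
  calc ∫ ω, W ω ^ 2 * ψ (C ω) ∂P
      = ∫ ω, (P[(fun ω => W ω ^ 2) * (ψ ∘ C) | MeasurableSpace.comap C inferInstance]) ω ∂P :=
        (integral_condExp hC.comap_le).symm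
    _ = ∫ ω, (fun t => e t * ψ t) (C ω) ∂P := by
        refine integral_congr_ae ?_
        filter_upwards [h1, he.ae_eq] with ω h h'
        rw [h, Pi.mul_apply, ← h', Function.comp_apply]
    _ = ∫ t, e t * ψ t ∂(P.map C) :=
        (integral_map hC.aemeasurable
          (he.measurable.mul hψ.measurable).aestronglyMeasurable).symm
    _ = ∫ t, ζ t * ψ t := by
        rw [hp.map_eq, integral_withDensity_eq_integral_toReal_smul
          hp.measurable.ennreal_ofReal (by simp)]
        congr 1 with t
        rw [ENNReal.toReal_ofReal (hp.nonneg t), hζ, smul_eq_mul, mul_assoc]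

end Weight

/-! ### The output function of a solution -/

section Output

variable {Ω : Type*} [MeasurableSpace Ω] {P : Measure Ω} {W B : Ω → ℝ}

lemma measurable_breakpoint (hW : Measurable W) (hB : Measurable B) :
    Measurable (breakpoint W B) := hB.neg.div hW

lemma memLp_relu [IsProbabilityMeasure P] (hW : Measurable W) (hB : Measurable B)
    (hW2 : MemLp W 2 P) (hB2 : MemLp B 2 P) (hW0 : P {ω | W ω = 0} = 0) (t : ℝ) :
    MemLp (fun z : ℝ × ℝ => max (z.1 * (t - z.2)) 0) 2 (breakpointLaw P W B) := by
  have hm : Measurable fun ω => (W ω, breakpoint W B ω) :=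
    hW.prodMk (measurable_breakpoint hW hB)
  have hc : Continuous fun z : ℝ × ℝ => max (z.1 * (t - z.2)) 0 := by fun_prop
  rw [breakpointLaw, memLp_map_measure_iff hc.aestronglyMeasurable hm.aemeasurable]
  have h : MemLp (fun ω => t * W ω + B ω) 2 P := (hW2.const_mul t).add hB2
  refine h.mono (hc.measurable.comp hm).aestronglyMeasurable ?_
  have h0 : ∀ᵐ ω ∂P, W ω ≠ 0 := by rw [ae_iff]; simpa using hW0
  filter_upwards [h0] with ω hω
  have : W ω * (t - breakpoint W B ω) = t * W ω + B ω := by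
    unfold breakpoint; field_simp; ring
  simp only [Function.comp_apply, this, Real.norm_eq_abs]
  rw [abs_of_nonneg (le_max_right _ _)]
  exact max_le (le_abs_self _) (abs_nonneg _)

/-- Up to an affine function, the output of a solution is the second antiderivative of `ζ` times
the spline of the multipliers. -/
lemma output_eq [IsProbabilityMeasure P] (hW : Measurable W) (hB : Measurable B)
    (hW2 : MemLp W 2 P) {p e ζ : ℝ → ℝ} (hp : IsDensityOf P (breakpoint W B) p)
    (he : IsCondExpFunction P (fun ω => W ω ^ 2) (breakpoint W B) e)
    (hζ : ∀ t, ζ t = p t * e t) {m : ℕ} {μ x : Fin m → ℝ} (h0 : ∑ j, μ j = 0)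
    (h1 : ∑ j, μ j * x j = 0) {γ : ℝ × ℝ → ℝ}
    (hγ : γ =ᵐ[breakpointLaw P W B] fun z => ∑ j, μ j * max (z.1 * (x j - z.2)) 0) (u v : ℝ) :
    ∃ a b : ℝ, ∀ t, output (breakpointLaw P W B) γ u v t
      = a * t + b + ∫ c, ζ c * spline μ x c * max (t - c) 0 := by
  set C := breakpoint W B
  have hC : Measurable C := measurable_breakpoint hW hB
  have hm : Measurable fun ω => (W ω, C ω) := hW.prodMk hC
  have hq := continuous_spline μ x
  have hqc := hasCompactSupport_spline h0 h1
  set N : Ω → ℝ := fun ω => (Iio (0 : ℝ)).indicator (fun w => w ^ 2) (W ω) with hN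
  have hNm : Measurable N := ((measurable_id.pow_const 2).indicator measurableSet_Iio).comp hW
  have hNi : Integrable N P := by
    refine hW2.integrable_sq.mono hNm.aestronglyMeasurable
      (Filter.Eventually.of_forall fun ω => ?_)
    simp only [hN]
    by_cases h : W ω ∈ Iio (0 : ℝ) <;> simp [h, sq_nonneg]
  have bdd : ∀ {ψ : ℝ → ℝ} {f : Ω → ℝ}, Continuous ψ → HasCompactSupport ψ → Integrable f P →
      Integrable (fun ω => f ω * ψ (C ω)) P := by
    intro ψ f hψ hψc hf
    obtain ⟨M, hM⟩ := hψ.bounded_above_of_compact_support hψc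
    exact hf.mul_bdd (hψ.measurable.comp hC).aestronglyMeasurable
      (Filter.Eventually.of_forall fun ω => hM _)
  have i1 : Integrable (fun ω => N ω * spline μ x (C ω)) P := bdd hq hqc hNi
  have i2 : Integrable (fun ω => N ω * (spline μ x (C ω) * C ω)) P :=
    bdd (ψ := fun c => spline μ x c * c) (hq.mul continuous_id) hqc.mul_right hNi
  refine ⟨u - ∫ ω, N ω * spline μ x (C ω) ∂P, v + ∫ ω, N ω * (spline μ x (C ω) * C ω) ∂P,
    fun t => ?_⟩
  have hψ : Continuous fun c => spline μ x c * max (t - c) 0 := by fun_prop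
  have hψc : HasCompactSupport fun c => spline μ x c * max (t - c) 0 := hqc.mul_right
  have i3 : Integrable (fun ω => W ω ^ 2 * (spline μ x (C ω) * max (t - C ω) 0)) P :=
    bdd (ψ := fun c => spline μ x c * max (t - c) 0) hψ hψc hW2.integrable_sq
  have e1 : ∫ z, γ z * max (z.1 * (t - z.2)) 0 ∂(breakpointLaw P W B)
      = ∫ ω, (∑ j, μ j * max (W ω * (x j - C ω)) 0) * max (W ω * (t - C ω)) 0 ∂P := by
    have : (fun z => γ z * max (z.1 * (t - z.2)) 0) =ᵐ[breakpointLaw P W B]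
        fun z => (∑ j, μ j * max (z.1 * (x j - z.2)) 0) * max (z.1 * (t - z.2)) 0 := by
      filter_upwards [hγ] with z hz
      rw [hz]
    have hcont : Continuous fun z : ℝ × ℝ =>
        (∑ j, μ j * max (z.1 * (x j - z.2)) 0) * max (z.1 * (t - z.2)) 0 := by fun_prop
    rw [integral_congr_ae this, breakpointLaw,
      integral_map hm.aemeasurable hcont.aestronglyMeasurable]
  have e2 := integral_sq_mul_comp hC hW2 hp he hζ hψ hψc
  simp_rw [← mul_assoc (ζ _)] at e2
  have e3 : ∀ ω, (∑ j, μ j * max (W ω * (x j - C ω)) 0) * max (W ω * (t - C ω)) 0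
      = W ω ^ 2 * (spline μ x (C ω) * max (t - C ω) 0)
        - (t * (N ω * spline μ x (C ω)) - N ω * (spline μ x (C ω) * C ω)) := fun ω => by
    rw [sum_relu_mul_relu h0 h1]
    simp only [hN]
    ring
  have i4 : Integrable (fun ω => t * (N ω * spline μ x (C ω))
      - N ω * (spline μ x (C ω) * C ω)) P := (i1.const_mul t).sub i2
  rw [output, e1]
  simp_rw [e3]
  rw [integral_sub i3 i4, integral_sub (i1.const_mul t) i2, integral_const_mul, e2]
  ring

end Output

/-! ### Second antiderivatives -/

lemma integral_mul_posPart {k : ℝ → ℝ} (hk : Integrable k) (hk1 : Integrable fun c => k c * c)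
    (t : ℝ) : ∫ c, k c * max (t - c) 0
      = t * (∫ c in Iic t, k c) - ∫ c in Iic t, k c * c := by
  rw [← integral_const_mul, ← integral_sub (hk.integrableOn.const_mul t) hk1.integrableOn,
    ← integral_indicator measurableSet_Iic]
  congr 1 with c
  by_cases hc : c ∈ Iic t
  · rw [indicator_of_mem hc, max_eq_left (sub_nonneg.2 hc)]; ring
  · rw [indicator_of_notMem hc, max_eq_right (sub_nonpos.2 (not_le.1 hc).le), mul_zero]

lemma setIntegral_Iic_eq_add {k : ℝ → ℝ} (hk : Integrable k) (s t : ℝ) :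
    ∫ c in Iic t, k c = (∫ c in Iic s, k c) + ∫ c in s..t, k c := by
  rw [← intervalIntegral.integral_Iic_sub_Iic hk.integrableOn hk.integrableOn]
  ring

lemma hasDerivAt_setIntegral_Iic {k : ℝ → ℝ} (hk : Integrable k) (hc : Continuous k) (t : ℝ) :
    HasDerivAt (fun t => ∫ c in Iic t, k c) (k t) t := by
  have : (fun t => ∫ c in Iic t, k c) = fun t => (∫ c in Iic 0, k c) + ∫ c in (0 : ℝ)..t, k c :=
    funext fun t => setIntegral_Iic_eq_add hk 0 t
  rw [this]
  exact (hc.integral_hasStrictDerivAt 0 t).hasDerivAt.const_add _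

/-- Convolution with `(·)₊` is a right inverse of the second derivative. -/
lemma contDiff_and_iteratedDeriv_two {g k : ℝ → ℝ} {a b : ℝ}
    (hk : Integrable k) (hk1 : Integrable fun c => k c * c)
    (hg : ∀ t, g t = a * t + b + ∫ c, k c * max (t - c) 0) (hc : Continuous k) :
    ContDiff ℝ 2 g ∧ iteratedDeriv 2 g = k := by
  have hg' : g = fun t => a * t + b + (t * (∫ c in Iic t, k c) - ∫ c in Iic t, k c * c) :=
    funext fun t => by rw [hg, integral_mul_posPart hk hk1]
  have d1 : ∀ t, HasDerivAt g (a + ∫ c in Iic t, k c) t := by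
    intro t
    rw [hg']
    have h := (((hasDerivAt_id t).const_mul a).add_const b).add
      (((hasDerivAt_id t).mul (hasDerivAt_setIntegral_Iic hk hc t)).sub
        (hasDerivAt_setIntegral_Iic hk1 (hc.mul continuous_id) t))
    refine h.congr_deriv ?_
    simp only [id]
    ring
  have e1 : deriv g = fun t => a + ∫ c in Iic t, k c := funext fun t => (d1 t).deriv
  have d2 : ∀ t, HasDerivAt (deriv g) (k t) t := fun t => by
    rw [e1]; exact (hasDerivAt_setIntegral_Iic hk hc t).const_add a
  have e2 : deriv (deriv g) = k := funext fun t => (d2 t).deriv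
  refine ⟨?_, by rw [iteratedDeriv_succ, iteratedDeriv_one, e2]⟩
  rw [show (2 : WithTop ℕ∞) = 1 + 1 by norm_num, contDiff_succ_iff_deriv]
  refine ⟨fun t => (d1 t).differentiableAt, by simp, ?_⟩
  rw [contDiff_one_iff_deriv, e2]
  exact ⟨fun t => (d2 t).differentiableAt, hc⟩

/-- Where the density vanishes, a second antiderivative is locally affine; no continuity of the
density elsewhere is needed. -/
lemma contDiffAt_and_iteratedDeriv_two_eq_zero {g k : ℝ → ℝ} {a b : ℝ}
    (hk : Integrable k) (hk1 : Integrable fun c => k c * c)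
    (hg : ∀ t, g t = a * t + b + ∫ c, k c * max (t - c) 0) {t : ℝ}
    (ht : k =ᶠ[nhds t] 0) : ContDiffAt ℝ 2 g t ∧ iteratedDeriv 2 g t = 0 := by
  obtain ⟨ε, hε, hball⟩ := Metric.eventually_nhds_iff_ball.1 ht
  have hloc : ∀ {f : ℝ → ℝ}, Integrable f → (∀ c ∈ Metric.ball t ε, f c = 0) →
      ∀ s ∈ Metric.ball t ε, ∫ c in Iic s, f c = ∫ c in Iic t, f c := by
    intro f hf hf0 s hs
    rw [setIntegral_Iic_eq_add hf t s, intervalIntegral.integral_congr (g := fun _ => 0)]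
    · simp
    · intro c hc
      have hconv : OrdConnected (Metric.ball t ε) := (convex_ball t ε).ordConnected
      exact hf0 c (hconv.uIcc_subset (Metric.mem_ball_self hε) hs hc)
  have heq : g =ᶠ[nhds t] fun s =>
      a * s + b + (s * (∫ c in Iic t, k c) - ∫ c in Iic t, k c * c) := by
    filter_upwards [Metric.ball_mem_nhds t hε] with s hs
    rw [hg, integral_mul_posPart hk hk1, hloc hk hball s hs,
      hloc hk1 (fun c hc => by simp [hball c hc]) s hs]
  have hcd : ContDiff ℝ 2 fun s : ℝ =>
      a * s + b + (s * (∫ c in Iic t, k c) - ∫ c in Iic t, k c * c) := by fun_prop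
  refine ⟨hcd.contDiffAt.congr_of_eventuallyEq heq, ?_⟩
  rw [heq.iteratedDeriv_eq]
  set A := ∫ c in Iic t, k c
  set D := ∫ c in Iic t, k c * c
  have h1 : ∀ s : ℝ, HasDerivAt (fun s : ℝ => a * s + b + (s * A - D)) (a + A) s := fun s => by
    have h := (((hasDerivAt_id s).const_mul a).add_const b).add
      (((hasDerivAt_id s).mul_const A).sub_const D)
    exact h.congr_deriv (by ring)
  rw [iteratedDeriv_succ, iteratedDeriv_one, funext fun s => (h1 s).deriv]
  simp

/-! ### Taylor's formula on the data interval -/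

/-- Taylor's formula with integral remainder, written with the kernel `(s - t)₊` so that the
integral runs over the whole interval. -/
lemma integral_curv_mul_posPart {φ : ℝ → ℝ} {a b : ℝ} (hab : a < b)
    (hφ : ContDiffOn ℝ 2 φ (Icc a b)) {s : ℝ} (hs : s ∈ Icc a b) :
    ∫ t in Icc a b, curv (Icc a b) φ t * max (s - t) 0
      = φ s - φ a - derivWithin φ (Icc a b) a * (s - a) := by
  have hu : UniqueDiffOn ℝ (Icc a b) := uniqueDiffOn_Icc hab
  have c2 : ContinuousOn (curv (Icc a b) φ) (Icc a b) :=
    hφ.continuousOn_iteratedDerivWithin le_rfl hu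
  have c1 : ContinuousOn (derivWithin φ (Icc a b)) (Icc a b) :=
    hφ.continuousOn_derivWithin hu (by norm_num)
  have d1 : DifferentiableOn ℝ (derivWithin φ (Icc a b)) (Icc a b) := by
    have := hφ.differentiableOn_iteratedDerivWithin (m := 1) (by norm_num) hu
    rwa [iteratedDerivWithin_one] at this
  have hsub : Icc a s ⊆ Icc a b := Icc_subset_Icc_right hs.2
  have key : ∫ t in a..s, curv (Icc a b) φ t * (s - t)
      = φ s - φ a - derivWithin φ (Icc a b) a * (s - a) := by
    -- `φ(t) + φ'(t) (s - t)` is an antiderivative of `φ''(t) (s - t)`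
    have h := intervalIntegral.integral_eq_sub_of_hasDerivAt_of_le
      (f := fun t => φ t + derivWithin φ (Icc a b) t * (s - t))
      (f' := fun t => curv (Icc a b) φ t * (s - t)) hs.1 ?_ ?_ ?_
    · rw [h]; ring
    · exact ((hφ.continuousOn.mono hsub).add ((c1.mono hsub).mul (by fun_prop)))
    · intro t ht
      have htn : Icc a b ∈ nhds t := Icc_mem_nhds ht.1 (ht.2.trans_le hs.2)
      have hti : t ∈ Icc a b := mem_of_mem_nhds htn
      have h1 : HasDerivAt φ (derivWithin φ (Icc a b) t) t :=
        ((hφ.differentiableOn (by norm_num) t hti).hasDerivWithinAt).hasDerivAt htn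
      have h2 : HasDerivAt (derivWithin φ (Icc a b)) (curv (Icc a b) φ t) t := by
        rw [curv, iteratedDerivWithin_succ, iteratedDerivWithin_one]
        exact ((d1 t hti).hasDerivWithinAt).hasDerivAt htn
      have h := h1.add (h2.mul ((hasDerivAt_id t).const_sub s))
      refine h.congr_deriv ?_
      simp only [id]
      ring
    · refine ContinuousOn.intervalIntegrable ?_
      rw [uIcc_of_le hs.1]
      exact (c2.mono hsub).mul (by fun_prop)
  rw [← key, intervalIntegral.integral_of_le hs.1, ← integral_Icc_eq_integral_Ioc]
  symm
  rw [← integral_indicator measurableSet_Icc, ← integral_indicator measurableSet_Icc]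
  congr 1 with t
  by_cases h : t ∈ Icc a s
  · rw [indicator_of_mem h, indicator_of_mem (hsub h), max_eq_left (sub_nonneg.2 h.2)]
  · rw [indicator_of_notMem h]
    by_cases h' : t ∈ Icc a b
    · rw [indicator_of_mem h', max_eq_right, mul_zero]
      exact sub_nonpos.2 (not_le.1 fun h'' => h ⟨h'.1, h''⟩).le
    · rw [indicator_of_notMem h']

/-! ### The weighted curvature cost -/

lemma cost_eq_lintegral {S : Set ℝ} {ζ k : ℝ → ℝ} (h0 : ∀ᵐ t ∂(volume.restrict S), 0 ≤ ζ t)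
    (hk : ∀ᵐ t ∂(volume.restrict S), ζ t = 0 → k t = 0) :
    cost S ζ k = ∫⁻ t in S, ENNReal.ofReal (k t ^ 2 / ζ t) := by
  refine lintegral_congr_ae ?_
  filter_upwards [h0, hk] with t ht hkt
  rcases ht.eq_or_lt with h | h
  · simp [hkt h.symm]
  · rw [ENNReal.ofReal_div_of_pos h]

lemma ae_eq_zero_of_cost_ne_top {S : Set ℝ} {ζ k : ℝ → ℝ} (hζ : Measurable ζ)
    (hk : AEMeasurable k (volume.restrict S)) (hfin : cost S ζ k ≠ ∞) :
    ∀ᵐ t ∂(volume.restrict S), ζ t = 0 → k t = 0 := by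
  have := ae_lt_top' ((hk.pow_const 2).ennreal_ofReal.div hζ.ennreal_ofReal.aemeasurable) hfin
  filter_upwards [this] with t ht h0
  by_contra hne
  simp only [Pi.div_apply, h0, ENNReal.ofReal_zero] at ht
  rw [ENNReal.div_zero (by simpa using hne)] at ht
  exact ht.ne rfl

/-- The identity holds for `z = 0` as well, since division by zero gives zero. -/
lemma sq_mul_div_self (z q : ℝ) : (z * q) ^ 2 / z = z * q ^ 2 := by
  by_cases h : z = 0
  · simp [h]
  · field_simp

/-- Pythagoras for the weighted cost: `∫ q d` is the inner product of `ζ q` and `d` with respect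
to the weight `1 / ζ`, so a deviation `d` from `ζ q` with `∫ q d = 0` adds its own cost. -/
lemma cost_eq_add {S : Set ℝ} {ζ q k : ℝ → ℝ} (hζ : Measurable ζ)
    (h0 : ∀ᵐ t ∂(volume.restrict S), 0 ≤ ζ t) (hk : AEMeasurable k (volume.restrict S))
    (hζq : IntegrableOn (fun t => ζ t * q t ^ 2) S)
    (hqd : IntegrableOn (fun t => (k t - ζ t * q t) * q t) S)
    (hqd0 : ∫ t in S, (k t - ζ t * q t) * q t = 0) (hfin : cost S ζ k ≠ ∞) :
    cost S ζ k = cost S ζ (fun t => ζ t * q t) + cost S ζ (fun t => k t - ζ t * q t) := by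
  have hz := ae_eq_zero_of_cost_ne_top hζ hk hfin
  have hd : ∀ᵐ t ∂(volume.restrict S), ζ t = 0 → k t - ζ t * q t = 0 := by
    filter_upwards [hz] with t ht h
    rw [ht h, h]; ring
  rw [cost_eq_lintegral h0 hz, cost_eq_lintegral h0 hd,
    cost_eq_lintegral h0 (Filter.Eventually.of_forall fun t h => by rw [h, zero_mul])]
  rw [cost_eq_lintegral h0 hz] at hfin
  have nn : ∀ f : ℝ → ℝ, 0 ≤ᵐ[volume.restrict S] fun t => f t ^ 2 / ζ t := fun f => by
    filter_upwards [h0] with t ht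
    exact div_nonneg (sq_nonneg _) ht
  have ik : IntegrableOn (fun t => k t ^ 2 / ζ t) S :=
    ⟨((hk.pow_const 2).div hζ.aemeasurable).aestronglyMeasurable,
      (hasFiniteIntegral_iff_ofReal (nn k)).2 hfin.lt_top⟩
  have eg : (fun t => (ζ t * q t) ^ 2 / ζ t) = fun t => ζ t * q t ^ 2 :=
    funext fun t => sq_mul_div_self _ _
  have ig : IntegrableOn (fun t => (ζ t * q t) ^ 2 / ζ t) S := by rw [eg]; exact hζq
  have ed : (fun t => (k t - ζ t * q t) ^ 2 / ζ t) =ᵐ[volume.restrict S]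
      fun t => k t ^ 2 / ζ t - (ζ t * q t) ^ 2 / ζ t - 2 * ((k t - ζ t * q t) * q t) := by
    filter_upwards [hz] with t ht
    by_cases h : ζ t = 0
    · simp [h, ht h]
    · field_simp
      ring
  have id' : IntegrableOn (fun t => (k t - ζ t * q t) ^ 2 / ζ t) S :=
    ((ik.sub ig).sub (hqd.const_mul 2)).congr ed.symm
  rw [← ofReal_integral_eq_lintegral_ofReal ik (nn _),
    ← ofReal_integral_eq_lintegral_ofReal ig (nn _),
    ← ofReal_integral_eq_lintegral_ofReal id' (nn _),
    ← ENNReal.ofReal_add (integral_nonneg_of_ae (nn _)) (integral_nonneg_of_ae (nn _)),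
    integral_congr_ae ed]
  have ikg : IntegrableOn (fun t => k t ^ 2 / ζ t - (ζ t * q t) ^ 2 / ζ t) S := ik.sub ig
  rw [integral_sub ikg (hqd.const_mul 2), integral_sub ik ig, integral_const_mul, hqd0]
  congr 1
  ring

lemma ae_eq_zero_of_cost_eq_zero {S : Set ℝ} {ζ k : ℝ → ℝ} (hζ : Measurable ζ)
    (hk : AEMeasurable k (volume.restrict S)) (h : cost S ζ k = 0) :
    ∀ᵐ t ∂(volume.restrict S), k t = 0 := by
  have h' := (lintegral_eq_zero_iff'
    ((hk.pow_const 2).ennreal_ofReal.div hζ.ennreal_ofReal.aemeasurable)).1 h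
  filter_upwards [h'] with t ht
  rw [Pi.zero_apply, Pi.div_apply, ENNReal.div_eq_zero_iff] at ht
  rcases ht with ht | ht
  · rw [ENNReal.ofReal_eq_zero] at ht
    exact pow_eq_zero_iff two_ne_zero |>.1 (le_antisymm ht (sq_nonneg _))
  · exact absurd ht ENNReal.ofReal_ne_top

/-! ### The variational problem in function space -/

section Variational

variable {m : ℕ} {x y μ : Fin m → ℝ} {ζ g : ℝ → ℝ}

lemma measurableSet_dataRegion : MeasurableSet (dataRegion ζ x) :=
  ((isClosed_tsupport ζ).inter isClosed_Icc).measurableSet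

/-- The density `ζ q` extends continuously by zero across the ends of the data interval, because
the spline vanishes there. -/
lemma continuous_zeta_mul_spline (h0 : ∑ j, μ j = 0) (h1 : ∑ j, μ j * x j = 0)
    (hc : ContinuousOn ζ (dataInterval x)) : Continuous fun t => ζ t * spline μ x t := by
  have e1 : ContinuousOn (fun t => ζ t * spline μ x t) (dataInterval x) :=
    hc.mul (continuous_spline μ x).continuousOn
  have e2 : ContinuousOn (fun t => ζ t * spline μ x t) (Iic (⨅ j, x j)) :=
    continuousOn_const.congr (f := fun _ => (0 : ℝ)) fun t ht => by
      simp only [spline_eq_zero_of_le h0 h1 ht, mul_zero]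
  have e3 : ContinuousOn (fun t => ζ t * spline μ x t) (Ici (⨆ j, x j)) :=
    continuousOn_const.congr (f := fun _ => (0 : ℝ)) fun t ht => by
      simp only [spline_eq_zero_of_ge (μ := μ) ht, mul_zero]
  rw [← continuousOn_univ]
  refine ((e1.union_of_isClosed e2 isClosed_Icc isClosed_Iic).union_of_isClosed e3
    (isClosed_Icc.union isClosed_Iic) isClosed_Ici).mono fun t _ => ?_
  rcases le_total t (⨅ j, x j) with h | h
  · exact Or.inl (Or.inr h)
  rcases le_total t (⨆ j, x j) with h' | h'
  · exact Or.inl (Or.inl ⟨h, h'⟩)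
  · exact Or.inr h'

/-- The spline is orthogonal to the curvature of every function vanishing at the data points. -/
lemma integral_curv_mul_spline (hab : ⨅ j, x j < ⨆ j, x j) (h0 : ∑ j, μ j = 0)
    (h1 : ∑ j, μ j * x j = 0) {φ : ℝ → ℝ} (hφ : ContDiffOn ℝ 2 φ (dataInterval x))
    (hφ0 : ∀ j, φ (x j) = 0) :
    ∫ t in dataInterval x, curv (dataInterval x) φ t * spline μ x t = 0 := by
  have c2 : ContinuousOn (curv (dataInterval x) φ) (dataInterval x) :=
    hφ.continuousOn_iteratedDerivWithin le_rfl (uniqueDiffOn_Icc hab)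
  have e : ∀ t, curv (dataInterval x) φ t * spline μ x t
      = ∑ j, μ j * (curv (dataInterval x) φ t * max (x j - t) 0) := fun t => by
    rw [spline, Finset.mul_sum]
    exact Finset.sum_congr rfl fun j _ => by ring
  have hi : ∀ j, IntegrableOn (fun t => μ j * (curv (dataInterval x) φ t * max (x j - t) 0))
      (dataInterval x) := fun j =>
    (ContinuousOn.integrableOn_compact isCompact_Icc (c2.mul (by fun_prop))).const_mul _
  simp_rw [e]
  rw [integral_finsetSum _ fun j _ => hi j]
  set a := ⨅ j, x j
  set D := derivWithin φ (dataInterval x) a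
  have : ∀ j, ∫ t in dataInterval x, μ j * (curv (dataInterval x) φ t * max (x j - t) 0)
      = (D * a - φ a) * μ j - D * (μ j * x j) := fun j => by
    rw [integral_const_mul, dataInterval,
      integral_curv_mul_posPart hab hφ (mem_dataInterval x j), hφ0]
    simp only [D, dataInterval, a]
    ring
  simp_rw [this]
  rw [Finset.sum_sub_distrib, ← Finset.mul_sum, ← Finset.mul_sum, h0, h1]
  ring

/-- A function without curvature on the data interval that vanishes at the data points vanishes
on the interval. -/
lemma eqOn_zero_of_curv_ae_eq_zero [Nonempty (Fin m)] (hab : ⨅ j, x j < ⨆ j, x j) {φ : ℝ → ℝ}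
    (hφ : ContDiffOn ℝ 2 φ (dataInterval x)) (hφ0 : ∀ j, φ (x j) = 0)
    (hc : ∀ᵐ t ∂(volume.restrict (dataInterval x)), curv (dataInterval x) φ t = 0) :
    EqOn φ 0 (dataInterval x) := by
  have taylor : ∀ s ∈ dataInterval x, φ s - φ (⨅ j, x j)
      - derivWithin φ (dataInterval x) (⨅ j, x j) * (s - ⨅ j, x j) = 0 := by
    intro s hs
    rw [dataInterval, ← integral_curv_mul_posPart hab hφ hs]
    refine integral_eq_zero_of_ae ?_
    filter_upwards [hc] with t ht
    rw [dataInterval] at ht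
    rw [ht, zero_mul, Pi.zero_apply]
  obtain ⟨i, hi⟩ := exists_eq_ciInf_of_finite (f := x)
  obtain ⟨j, hj⟩ := exists_eq_ciSup_of_finite (f := x)
  have ha : φ (⨅ j, x j) = 0 := by rw [← hi]; exact hφ0 i
  have hb := taylor _ (mem_dataInterval x j)
  rw [hφ0, ha, hj] at hb
  have hD : derivWithin φ (dataInterval x) (⨅ j, x j) = 0 := by
    have : derivWithin φ (dataInterval x) (⨅ j, x j) * ((⨆ j, x j) - ⨅ j, x j) = 0 := by
      linarith
    exact (mul_eq_zero.1 this).resolve_right (sub_pos.2 hab).ne'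
  intro s hs
  have := taylor s hs
  rw [ha, hD] at this
  simpa using this

/-- If all data points coincide, every interpolant is optimal: the region of integration is a
null set. -/
lemma cost_dataRegion_eq_zero (hab : ¬ ⨅ j, x j < ⨆ j, x j) (k : ℝ → ℝ) :
    cost (dataRegion ζ x) ζ k = 0 := by
  have h : volume (dataRegion ζ x) = 0 := by
    refine measure_mono_null inter_subset_right ?_
    rw [dataInterval, Real.volume_Icc, ENNReal.ofReal_eq_zero]
    linarith [not_lt.1 hab]
  rw [cost, Measure.restrict_eq_zero.2 h, lintegral_zero_measure]

lemma eq_data_of_mem_dataInterval [Nonempty (Fin m)] (hab : ¬ ⨅ j, x j < ⨆ j, x j) {t : ℝ}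
    (ht : t ∈ dataInterval x) : ∃ j, x j = t := by
  obtain ⟨i, hi⟩ := exists_eq_ciInf_of_finite (f := x)
  exact ⟨i, by rw [hi]; exact le_antisymm ht.1 (ht.2.trans (not_lt.1 hab))⟩

/-- A `C²` interpolant whose second derivative is `ζ` times the spline of the multipliers is the
solution of the variational problem. -/
lemma isTheMinimizer_gapInterpolants [Nonempty (Fin m)] (hx : ∀ j, x j ∈ tsupport ζ)
    (hζ : Measurable ζ) (hζ0 : ∀ᵐ t : ℝ, 0 ≤ ζ t)
    (hc : ContinuousOn ζ (dataInterval x)) (h0 : ∑ j, μ j = 0) (h1 : ∑ j, μ j * x j = 0)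
    (hg : ContDiff ℝ 2 g) (hg2 : iteratedDeriv 2 g = fun t => ζ t * spline μ x t)
    (hgy : ∀ j, g (x j) = y j) :
    IsTheMinimizer (dataInterval x) (gapInterpolants (dataInterval x) (dataRegion ζ x) 0 x y)
      (fun h => cost (dataRegion ζ x) ζ (curv (dataInterval x) h)) g := by
  set I := dataInterval x with hI
  set S := dataRegion ζ x with hS
  have hSI : S ⊆ I := inter_subset_right
  by_cases hab : ⨅ j, x j < ⨆ j, x j
  swap
  · refine ⟨⟨by simpa using hg.contDiffOn, fun t ht => ?_, hgy⟩, ?_, fun h _ => ?_,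
      fun h hh _ t ht => ?_⟩
    · obtain ⟨j, rfl⟩ := eq_data_of_mem_dataInterval hab ht.1
      exact absurd ⟨hx j, ht.1⟩ ht.2
    · simp only [hS, cost_dataRegion_eq_zero hab, ENNReal.zero_lt_top]
    · simp only [hS, cost_dataRegion_eq_zero hab, le_refl]
    · obtain ⟨j, rfl⟩ := eq_data_of_mem_dataInterval hab ht
      rw [hh.2.2 j, hgy]
  have hu : UniqueDiffOn ℝ I := uniqueDiffOn_Icc hab
  have hSm : MeasurableSet S := measurableSet_dataRegion
  have hIm : MeasurableSet I := measurableSet_Icc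
  set q := spline μ x with hq
  have hqc : Continuous q := continuous_spline μ x
  have hkc : Continuous fun t => ζ t * q t := continuous_zeta_mul_spline h0 h1 hc
  have hζ0S : ∀ᵐ t ∂(volume.restrict S), 0 ≤ ζ t := ae_restrict_of_ae hζ0
  have cg : ∀ t ∈ I, curv I g t = ζ t * q t := fun t ht => by
    rw [curv, iteratedDerivWithin_eq_iteratedDeriv hu hg.contDiffAt ht, hg2]
  have hζq : IntegrableOn (fun t => ζ t * q t ^ 2) S := by
    have : (fun t => ζ t * q t ^ 2) = fun t => (ζ t * q t) * q t := by funext t; ring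
    rw [this]
    exact ((hkc.mul hqc).continuousOn.integrableOn_compact isCompact_Icc).mono_set hSI
  have costg : cost S ζ (curv I g) = cost S ζ (fun t => ζ t * q t) :=
    setLIntegral_congr_fun hSm fun t ht => by simp only [cg t (hSI ht)]
  have fing : cost S ζ (fun t => ζ t * q t) < ∞ := by
    rw [cost_eq_lintegral hζ0S (Filter.Eventually.of_forall fun t h => by rw [h, zero_mul])]
    have eg : (fun t => (ζ t * q t) ^ 2 / ζ t) = fun t => ζ t * q t ^ 2 :=
      funext fun t => sq_mul_div_self _ _
    simp_rw [funext_iff.1 eg]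
    refine (hasFiniteIntegral_iff_ofReal ?_).1 hζq.2
    filter_upwards [hζ0S] with t ht
    exact mul_nonneg ht (sq_nonneg _)
  have main : ∀ h ∈ gapInterpolants I S 0 x y, cost S ζ (curv I h) ≠ ∞ →
      cost S ζ (curv I h) = cost S ζ (fun t => ζ t * q t)
        + cost S ζ (fun t => curv I h t - ζ t * q t) ∧
      ((∀ᵐ t ∂(volume.restrict S), curv I h t - ζ t * q t = 0) → EqOn h g I) := by
    rintro h ⟨hh, hgap, hy⟩ hfin
    rw [sub_zero] at hh
    have hφ : ContDiffOn ℝ 2 (h - g) I := hh.sub hg.contDiffOn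
    have hφ0 : ∀ j, (h - g) (x j) = 0 := fun j => by simp [hy j, hgy j]
    have cφ : ∀ t ∈ I, curv I (h - g) t = curv I h t - ζ t * q t := fun t ht => by
      rw [← cg t ht]
      exact iteratedDerivWithin_sub ht hu (hh t ht) (hg.contDiffOn t ht)
    have dgap : ∀ t ∈ I \ S, curv I h t - ζ t * q t = 0 := fun t ht => by
      have := hgap t ht
      rw [sub_zero] at this
      have hz : ζ t = 0 := image_eq_zero_of_notMem_tsupport fun h' => ht.2 ⟨h', ht.1⟩
      rw [this, hz]; ring
    have ch : ContinuousOn (curv I h) I := hh.continuousOn_iteratedDerivWithin le_rfl hu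
    have hkm : AEMeasurable (curv I h) (volume.restrict S) :=
      (ch.mono hSI).aemeasurable hSm
    have hqd : IntegrableOn (fun t => (curv I h t - ζ t * q t) * q t) I :=
      ((ch.sub hkc.continuousOn).mul hqc.continuousOn).integrableOn_compact isCompact_Icc
    refine ⟨cost_eq_add hζ hζ0S hkm hζq (hqd.mono_set hSI) ?_ hfin, fun hd => ?_⟩
    · rw [← setIntegral_eq_of_subset_of_forall_sdiff_eq_zero hIm hSI
        (fun t ht => by rw [dgap t ht, zero_mul]),
        ← integral_curv_mul_spline hab h0 h1 hφ hφ0]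
      exact setIntegral_congr_fun hIm fun t ht => by simp only [cφ t ht, ← hI, hq]
    · have hd' : ∀ᵐ t ∂(volume.restrict I), curv I (h - g) t = 0 := by
        rw [ae_restrict_iff' hSm] at hd
        rw [ae_restrict_iff' hIm]
        filter_upwards [hd] with t ht htI
        rw [cφ t htI]
        by_cases htS : t ∈ S
        · exact ht htS
        · exact dgap t ⟨htI, htS⟩
      intro t ht
      exact sub_eq_zero.1 (eqOn_zero_of_curv_ae_eq_zero hab hφ hφ0 hd' ht)
  refine ⟨⟨by simpa using hg.contDiffOn, fun t ht => ?_, hgy⟩, ?_, fun h hh => ?_,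
    fun h hh hle => ?_⟩
  · have hz : ζ t = 0 := image_eq_zero_of_notMem_tsupport fun h' => ht.2 ⟨h', ht.1⟩
    rw [sub_zero, cg t ht.1, hz, zero_mul]
  · simpa only [costg] using fing
  · simp only [costg]
    by_cases hfin : cost S ζ (curv I h) = ∞
    · rw [hfin]; exact le_top
    · rw [(main h hh hfin).1]; exact le_self_add
  · simp only [costg] at hle
    have hfin := (hle.trans_lt fing).ne
    obtain ⟨e, huniq⟩ := main h hh hfin
    refine huniq (ae_eq_zero_of_cost_eq_zero hζ ?_ ?_)
    · have hh' := hh.1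
      rw [sub_zero] at hh'
      have ch : ContinuousOn (curv I h) I := hh'.continuousOn_iteratedDerivWithin le_rfl hu
      exact ((ch.mono hSI).aemeasurable hSm).sub hkc.measurable.aemeasurable
    · rw [e] at hle
      have := ENNReal.le_of_add_le_add_left fing.ne (hle.trans_eq (add_zero _).symm)
      exact le_antisymm this bot_le

end Variational

/-! ### Transfer between the problems -/

/-- The extreme data points lie in the support, so an interval `S` is all of the data interval. -/
lemma dataRegion_eq_dataInterval {m : ℕ} [Nonempty (Fin m)] {ζ : ℝ → ℝ} {x : Fin m → ℝ}
    (hx : ∀ j, x j ∈ tsupport ζ) (h : (dataRegion ζ x).OrdConnected) :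
    dataRegion ζ x = dataInterval x := by
  refine Subset.antisymm inter_subset_right ?_
  obtain ⟨i, hi⟩ := exists_eq_ciInf_of_finite (f := x)
  obtain ⟨j, hj⟩ := exists_eq_ciSup_of_finite (f := x)
  have := h.out ⟨hx i, mem_dataInterval x i⟩ ⟨hx j, mem_dataInterval x j⟩
  rwa [hi, hj] at this

lemma gapInterpolants_self (D : Set ℝ) {m : ℕ} (x y : Fin m → ℝ) :
    gapInterpolants D D 0 x y = interpolants D x y := by
  ext h
  simp [gapInterpolants, interpolants]

lemma IsTheMinimizer.shift {D : Set ℝ} {A A' : Set (ℝ → ℝ)} {J : (ℝ → ℝ) → ℝ≥0∞}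
    {g f₀ : ℝ → ℝ} (hg : IsTheMinimizer D A J (g - f₀)) (hA : ∀ h, h ∈ A' ↔ h - f₀ ∈ A) :
    IsTheMinimizer D A' (fun h => J (h - f₀)) g where
  mem := (hA g).2 hg.mem
  finite := hg.finite
  minimal h hh := hg.minimal _ ((hA h).1 hh)
  unique h hh hle t ht := by
    have := hg.unique _ ((hA h).1 hh) hle ht
    simpa using this

lemma IsTheMinimizer.congr {D : Set ℝ} {A A' : Set (ℝ → ℝ)} {J J' : (ℝ → ℝ) → ℝ≥0∞}
    {g : ℝ → ℝ} (hg : IsTheMinimizer D A J g) (hA : A = A') (hJ : ∀ h ∈ A, J h = J' h) :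
    IsTheMinimizer D A' J' g := by
  subst hA
  exact ⟨hg.mem, by rw [← hJ g hg.mem]; exact hg.finite,
    fun h hh => by rw [← hJ g hg.mem, ← hJ h hh]; exact hg.minimal h hh,
    fun h hh hle => hg.unique h hh (by rwa [hJ g hg.mem, hJ h hh])⟩

lemma cost_curv_sub {m : ℕ} {ζ h f₀ : ℝ → ℝ} {x : Fin m → ℝ}
    (hS : dataRegion ζ x = dataInterval x) (hh : ContDiffOn ℝ 2 h (dataRegion ζ x))
    (hf : ContDiffOn ℝ 2 f₀ (dataRegion ζ x)) :
    cost (dataRegion ζ x) ζ (curv (dataRegion ζ x) (h - f₀))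
      = cost (dataRegion ζ x) ζ
          (fun t => curv (dataRegion ζ x) h t - curv (dataRegion ζ x) f₀ t) := by
  by_cases hab : ⨅ j, x j < ⨆ j, x j
  · have hu : UniqueDiffOn ℝ (dataRegion ζ x) := by rw [hS]; exact uniqueDiffOn_Icc hab
    refine setLIntegral_congr_fun measurableSet_dataRegion fun t ht => ?_
    simp only [curv, iteratedDerivWithin_sub ht hu (hh t ht) (hf t ht)]
  · rw [cost_dataRegion_eq_zero hab, cost_dataRegion_eq_zero hab]

/-! ### Characterization of the learned function -/

/-- The statement with zero initial function, for arbitrary data values. -/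
lemma IsParamSolution.characterization {Ω : Type*} [MeasurableSpace Ω] {P : Measure Ω}
    [IsProbabilityMeasure P] {W B : Ω → ℝ} (hW : Measurable W) (hB : Measurable B)
    (hW2 : MemLp W 2 P) (hB2 : MemLp B 2 P) (hW0 : P {ω | W ω = 0} = 0) {p e ζ : ℝ → ℝ}
    (hp : IsDensityOf P (breakpoint W B) p)
    (he : IsCondExpFunction P (fun ω => W ω ^ 2) (breakpoint W B) e)
    (hζ : ∀ t, ζ t = p t * e t) {m : ℕ} (hm : 0 < m) {x y : Fin m → ℝ}
    (hx : ∀ j, x j ∈ tsupport ζ) {γ : ℝ × ℝ → ℝ} {u v : ℝ} {g : ℝ → ℝ}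
    (hsol : IsParamSolution (breakpointLaw P W B) x y γ u v)
    (hg : ∀ t, g t = output (breakpointLaw P W B) γ u v t) :
    (∀ t, t ∉ dataRegion ζ x → ContDiffAt ℝ 2 g t ∧ iteratedDeriv 2 g t = 0) ∧
    ((dataRegion ζ x).OrdConnected → ContinuousOn ζ (dataRegion ζ x) →
      IsTheMinimizer (dataRegion ζ x) (interpolants (dataRegion ζ x) x y)
        (fun h => cost (dataRegion ζ x) ζ (curv (dataRegion ζ x) h)) g) ∧
    (ContinuousOn ζ (dataInterval x) →
      IsTheMinimizer (dataInterval x)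
        (gapInterpolants (dataInterval x) (dataRegion ζ x) 0 x y)
        (fun h => cost (dataRegion ζ x) ζ (curv (dataInterval x) h)) g) := by
  have : Nonempty (Fin m) := ⟨⟨0, hm⟩⟩
  have hC := measurable_breakpoint hW hB
  obtain ⟨μ, h0, h1, hγ⟩ := hsol.exists_multipliers (memLp_relu hW hB hW2 hB2 hW0)
  obtain ⟨a, b, hab⟩ := output_eq hW hB hW2 hp he hζ h0 h1 hγ u v
  have hg' : ∀ t, g t = a * t + b + ∫ c, ζ c * spline μ x c * max (t - c) 0 :=
    fun t => (hg t).trans (hab t)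
  have hζi := integrable_zeta hC hp he hζ
  have hζm : Measurable ζ := by
    rw [funext hζ]; exact hp.measurable.mul he.measurable
  have hq := continuous_spline μ x
  have hqc := hasCompactSupport_spline h0 h1
  have bdd : ∀ {ψ : ℝ → ℝ}, Continuous ψ → HasCompactSupport ψ →
      Integrable fun c => ζ c * ψ c := by
    intro ψ hψ hψc
    obtain ⟨M, hM⟩ := hψ.bounded_above_of_compact_support hψc
    exact hζi.mul_bdd hψ.aestronglyMeasurable (Filter.Eventually.of_forall hM)
  have hk : Integrable fun c => ζ c * spline μ x c := bdd hq hqc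
  have hk1 : Integrable fun c => ζ c * spline μ x c * c := by
    simp_rw [mul_assoc]
    exact bdd (ψ := fun c => spline μ x c * c) (hq.mul continuous_id) hqc.mul_right
  have gap : ContinuousOn ζ (dataInterval x) → IsTheMinimizer (dataInterval x)
      (gapInterpolants (dataInterval x) (dataRegion ζ x) 0 x y)
      (fun h => cost (dataRegion ζ x) ζ (curv (dataInterval x) h)) g := by
    intro hc
    obtain ⟨hcd, h2⟩ := contDiff_and_iteratedDeriv_two hk hk1 hg'
      (continuous_zeta_mul_spline h0 h1 hc)
    exact isTheMinimizer_gapInterpolants hx hζm (ae_zeta_nonneg hC hp he hζ) hc h0 h1 hcd h2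
      fun j => (hg _).trans (hsol.feasible.interp j)
  refine ⟨fun t ht => ?_, fun hS hc => ?_, gap⟩
  · refine contDiffAt_and_iteratedDeriv_two_eq_zero hk hk1 hg' ?_
    by_cases hts : t ∈ tsupport ζ
    · have : t ∈ (dataInterval x)ᶜ := fun h => ht ⟨hts, h⟩
      filter_upwards [isClosed_Icc.isOpen_compl.mem_nhds this] with c hc
      simp [spline_eq_zero_of_notMem h0 h1 hc]
    · filter_upwards [(isClosed_tsupport ζ).isOpen_compl.mem_nhds hts] with c hc
      simp [image_eq_zero_of_notMem_tsupport hc]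
  · have e := dataRegion_eq_dataInterval hx hS
    have h := gap (e ▸ hc)
    rw [e] at h ⊢
    rwa [gapInterpolants_self] at h

end ReLUBias

theorem mainTheorem2 {Ω : Type*} [MeasurableSpace Ω] (P : Measure Ω) [IsProbabilityMeasure P]
    (W B : Ω → ℝ) (hW : Measurable W) (hB : Measurable B)
    (hW2 : MemLp W 2 P) (hB2 : MemLp B 2 P)
    (hW0 : P {ω | W ω = 0} = 0)
    (p e ζ : ℝ → ℝ)
    (hp : ReLUBias.IsDensityOf P (ReLUBias.breakpoint W B) p)
    (he : ReLUBias.IsCondExpFunction P (fun ω => W ω ^ 2) (ReLUBias.breakpoint W B) e)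
    (hζ : ∀ t, ζ t = p t * e t)
    (m : ℕ) (hm : 0 < m) (x y : Fin m → ℝ) (hx : ∀ j, x j ∈ tsupport ζ)
    (ν : Measure (ℝ × ℝ)) (hν : ν = ReLUBias.breakpointLaw P W B)
    (I S : Set ℝ) (hI : I = ReLUBias.dataInterval x) (hS : S = ReLUBias.dataRegion ζ x) :
    -- the statement with zero initial function
    (∀ (γ : ℝ × ℝ → ℝ) (u v : ℝ) (g : ℝ → ℝ),
      ReLUBias.IsParamSolution ν x y γ u v →
      (∀ t, g t = ReLUBias.output ν γ u v t) →
      (∀ t, t ∉ S → ContDiffAt ℝ 2 g t ∧ iteratedDeriv 2 g t = 0) ∧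
      (S.OrdConnected → ContinuousOn ζ S →
        ReLUBias.IsTheMinimizer S (ReLUBias.interpolants S x y)
          (fun h => ReLUBias.cost S ζ (ReLUBias.curv S h)) g) ∧
      (ContinuousOn ζ I →
        ReLUBias.IsTheMinimizer I (ReLUBias.gapInterpolants I S 0 x y)
          (fun h => ReLUBias.cost S ζ (ReLUBias.curv I h)) g)) ∧
    -- the statement for an arbitrary initial network function `f₀ = f(·, θ₀)`
    (∀ (n : ℕ) (θ₀ : ReLUBias.NetParams n) (f₀ : ℝ → ℝ) (γ : ℝ × ℝ → ℝ) (u v : ℝ) (g : ℝ → ℝ),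
      f₀ = ReLUBias.network θ₀ →
      ReLUBias.IsParamSolution ν x (fun j => y j - f₀ (x j)) γ u v →
      (∀ t, g t = ReLUBias.output ν γ u v t + f₀ t) →
      (∀ t, t ∉ S → ContDiffAt ℝ 2 (g - f₀) t ∧ iteratedDeriv 2 (g - f₀) t = 0) ∧
      (∀ t, t ∉ S → ContDiffAt ℝ 2 f₀ t →
        ContDiffAt ℝ 2 g t ∧ iteratedDeriv 2 g t = iteratedDeriv 2 f₀ t) ∧
      (S.OrdConnected → ContinuousOn ζ S →
        ReLUBias.IsTheMinimizer S (ReLUBias.shiftedInterpolants S f₀ x y)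
          (fun h => ReLUBias.cost S ζ (ReLUBias.curv S (h - f₀))) g) ∧
      (S.OrdConnected → ContinuousOn ζ S → ContDiffOn ℝ 2 f₀ S →
        ReLUBias.IsTheMinimizer S (ReLUBias.interpolants S x y)
          (fun h => ReLUBias.cost S ζ
            (fun t => ReLUBias.curv S h t - ReLUBias.curv S f₀ t)) g) ∧
      (ContinuousOn ζ I →
        ReLUBias.IsTheMinimizer I (ReLUBias.gapInterpolants I S f₀ x y)
          (fun h => ReLUBias.cost S ζ (ReLUBias.curv I (h - f₀))) g)) := by
  subst hν hI hS
  have partA := fun (y : Fin m → ℝ) (γ : ℝ × ℝ → ℝ) (u v : ℝ) (g : ℝ → ℝ)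
      (hsol : ReLUBias.IsParamSolution (ReLUBias.breakpointLaw P W B) x y γ u v)
      (hg : ∀ t, g t = ReLUBias.output (ReLUBias.breakpointLaw P W B) γ u v t) =>
    hsol.characterization hW hB hW2 hB2 hW0 hp he hζ hm hx hg
  refine ⟨partA y, fun n θ₀ f₀ γ u v g _ hsol hg => ?_⟩
  obtain ⟨h1, h2, h3⟩ := partA _ γ u v (g - f₀) hsol fun t => by simp [hg]
  have shifted : (ReLUBias.dataRegion ζ x).OrdConnected →
      ContinuousOn ζ (ReLUBias.dataRegion ζ x) →
      ReLUBias.IsTheMinimizer (ReLUBias.dataRegion ζ x)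
        (ReLUBias.shiftedInterpolants (ReLUBias.dataRegion ζ x) f₀ x y)
        (fun h => ReLUBias.cost (ReLUBias.dataRegion ζ x) ζ
          (ReLUBias.curv (ReLUBias.dataRegion ζ x) (h - f₀))) g := fun hS hc =>
    (h2 hS hc).shift fun h => by
      simp [ReLUBias.shiftedInterpolants, ReLUBias.interpolants]
  refine ⟨h1, fun t ht hf => ?_, shifted, fun hS hc hf => ?_, fun hc => ?_⟩
  · obtain ⟨hcd, hd⟩ := h1 t ht
    have hgd : ContDiffAt ℝ 2 g t := by simpa using hcd.add hf
    refine ⟨hgd, ?_⟩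
    rw [iteratedDeriv_sub hgd hf] at hd
    exact sub_eq_zero.1 hd
  · have : Nonempty (Fin m) := ⟨⟨0, hm⟩⟩
    have mem_iff : ∀ h, ContDiffOn ℝ 2 (h - f₀) (ReLUBias.dataRegion ζ x) ↔
        ContDiffOn ℝ 2 h (ReLUBias.dataRegion ζ x) := fun h =>
      ⟨fun hh => by simpa using hh.add hf, fun hh => hh.sub hf⟩
    refine (shifted hS hc).congr ?_ fun h hh => ?_
    · ext h
      simp only [ReLUBias.shiftedInterpolants, ReLUBias.interpolants, mem_ofPred_eq, mem_iff]
    · exact ReLUBias.cost_curv_sub (ReLUBias.dataRegion_eq_dataInterval hx hS)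
        ((mem_iff h).1 hh.1) hf
  · exact (h3 hc).shift fun h => by simp [ReLUBias.gapInterpolants]
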